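/- Let $L$ be a number field with ring of integers $\mathcal O_L$, let $E/L$ be an elliptic curve with $j(E)\notin\{0,1728\}$, and let $\mathfrak p$ be a nonzero prime ideal of $\mathcal O_L$ at which $E$ has good reduction. Write $\mathrm N(\mathfrak p)$ for the norm of $\mathfrak p$, $v_{\mathfrak p}$ for the (additive) $\mathfrak p$-adic valuation on $L$ and $\mathbb F_{\mathfrak p}$ for the residue field at $\mathfrak p$. Put $a_{\mathfrak p}(E)=\mathrm N(\mathfrak p)+1-|E(\mathbb F_{\mathfrak p})|$, where $E(\mathbb F_{\mathfrak p})$ is the set of $\mathbb F_{\mathfrak p}$-points of the reduction of $E$ modulo $\mathfrak p$. For $a\in L$ with $v_{\mathfrak p}(a)\ge 0$, let $\left(\frac{a}{\mathfrak p}\right)$ be $0$, $1$ or $-1$ according as the image of $a$ in $\mathbb F_{\mathfrak p}$ is zero, a nonzero square, or a non-square. Let $(a)_m=\prod_{i=0}^{m-1}(a+i)$ and, for $r\ge 0$, let $${}_3F_2\left[\begin{matrix}\tfrac12,\tfrac16,\tfrac56\\ 1,1\end{matrix};z\right]_r=\sum_{m=0}^{r}\frac{(\frac12)_m(\frac16)_m(\frac56)_m}{(1)_m(1)_m}\cdot\frac{z^m}{m!}.$$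 Suppose that $\mathfrak p\nmid 6$ and $v_{\mathfrak p}(j(E))=0=v_{\mathfrak p}(j(E)-1728)$. Then $$a_{\mathfrak p}(E)^2\equiv\left(\frac{1-1728/j(E)}{\mathfrak p}\right)\cdot{}_3F_2\left[\begin{matrix}\tfrac12,\tfrac16,\tfrac56\\ 1,1\end{matrix};\frac{1728}{j(E)}\right]_{\mathrm N(\mathfrak p)-1}\pmod{\mathfrak p},$$ that is, the difference of the two sides, an element of $L$, has $\mathfrak p$-adic valuation at least $1$. -/

import Mathlib

open IsDedekindDomain NumberField

noncomputable section

/-- The truncated hypergeometric sum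
`∑_{m=0}^{r} ((α₁)_m ⋯ (αₙ₊₁)_m) / ((β₁)_m ⋯ (βₙ)_m) * z ^ m / m!`,
where `(a)_m = a (a + 1) ⋯ (a + m - 1)` is the rising factorial. -/
def truncatedHypergeometric {K : Type*} [Field K] {n : ℕ}
    (α : Fin (n + 1) → K) (β : Fin n → K) (z : K) (r : ℕ) : K :=
  ∑ m ∈ Finset.range (r + 1),
    (∏ i, (ascPochhammer K m).eval (α i)) / (∏ i, (ascPochhammer K m).eval (β i)) *
      (z ^ m / (m.factorial : K))

section NumberField

variable {L : Type*} [Field L] [NumberField L]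

/-- The local ring at a prime `v` of the number field `L`, i.e. the discrete valuation ring of all
elements of `L` with nonnegative (additive) `v`-adic valuation. -/
abbrev LocalRingAt (v : HeightOneSpectrum (𝓞 L)) : Type _ := (v.valuation L).integer

/-- The residue field at `v`. -/
abbrev ResidueFieldAt (v : HeightOneSpectrum (𝓞 L)) : Type _ :=
  IsLocalRing.ResidueField (LocalRingAt v)

open scoped Classical in
/-- The quadratic residue symbol at a prime `v` of `L`: for `a` with nonnegative valuation at `v` it
is `0`, `1` or `-1` according as the image of `a` in the residue field is zero, a nonzero square, or
not a square. Elements that are not `v`-integral get the junk value `0`. -/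
def primeLegendreSym (v : HeightOneSpectrum (𝓞 L)) (a : L) : ℤ :=
  if h : v.valuation L a ≤ 1 then
    let abar : ResidueFieldAt v := IsLocalRing.residue (LocalRingAt v) ⟨a, h⟩
    if abar = 0 then 0 else if IsSquare abar then 1 else -1
  else 0

/-- `v` is a good prime of `E`: a minimal Weierstrass equation of `E` at `v` has good reduction. -/
def IsGoodPrime (E : WeierstrassCurve L) (v : HeightOneSpectrum (𝓞 L)) : Prop :=
  (E.minimal (LocalRingAt v)).HasGoodReduction (LocalRingAt v)

/-- `a_v(E) = N(v) + 1 - |E(𝔽_v)|`, where `E(𝔽_v)` is the set of points over the residue field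
(including the point at infinity) of the reduction of a minimal Weierstrass equation of `E`. -/
def frobeniusTrace (E : WeierstrassCurve L) (v : HeightOneSpectrum (𝓞 L)) : ℤ :=
  (Ideal.absNorm v.asIdeal : ℤ) + 1 -
    (Nat.card ((E.minimal (LocalRingAt v)).reduction (LocalRingAt v)).toAffine.Point : ℤ)

/-- Congruence modulo `v` for elements of `L`: the difference lies in the maximal ideal of the local
ring at `v`, i.e. it has (additive) valuation at least `1`. -/
def CongrModPrime (v : HeightOneSpectrum (𝓞 L)) (x y : L) : Prop :=
  v.valuation L (x - y) < 1

end NumberField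

end

/-! Everything takes place on the reduction `W` over the residue field, with q = p^f = 2n + 1
elements. Euler's criterion and power sums over the field make the trace of Frobenius the Hasse
invariant, the coefficient of x^(q-1) in `Ψ₂Sq ^ n` (`cast_trace_eq_coeff`).

Over the algebraic closure choose α with α² = c₄. An affine substitution turns `Ψ₂Sq` into α³(4X³ +
X² - 4s) with s(1 - 432s) = 1/j, and changes the coefficient only by a power of α
(`coeff_comp_linear`). For this trinomial the coefficient is the truncated ₂F₁-type sum of
(6l)!/((3l)!(2l)!l!) s^l (`coeff_trinomial_pow_eq_sum`).

Clausen's formula (`coeff_sexticSeries_sq`) writes the square of the full series as a series in s(1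
- 432s). Modulo p it holds exactly for the truncations, because the coefficients vanish beyond q/6
(`sum_sexticBinom_sq`). Hence the square of the trace is c₄^n times the ₃F₂ sum, and c₄^n is the
quadratic character of c₆²/c₄³ = 1 - 1728/j. -/

/-- `(6m)! / ((3m)! (2m)! m!)`. -/
def sexticBinom (m : ℕ) : ℕ := (6 * m).choose (3 * m) * (3 * m).choose m

/-- `(6m)! / ((3m)! m! ^ 3)`. -/
def sexticCubeBinom (m : ℕ) : ℕ := sexticBinom m * m.centralBinom

theorem sexticBinom_mul_factorials (m : ℕ) :
    sexticBinom m * ((3 * m).factorial * (2 * m).factorial * m.factorial) =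
      (6 * m).factorial := by
  have h1 := Nat.choose_mul_factorial_mul_factorial (show 3 * m ≤ 6 * m by lia)
  have h2 := Nat.choose_mul_factorial_mul_factorial (show m ≤ 3 * m by lia)
  rw [show 6 * m - 3 * m = 3 * m by lia] at h1
  rw [show 3 * m - m = 2 * m by lia] at h2
  calc _ = (6 * m).choose (3 * m) * (3 * m).factorial *
        ((3 * m).choose m * m.factorial * (2 * m).factorial) := by rw [sexticBinom]; ring
    _ = _ := by rw [h2, h1]

theorem sexticBinom_succ (m : ℕ) :
    sexticBinom (m + 1) * (m + 1) ^ 2 = 12 * (6 * m + 1) * (6 * m + 5) * sexticBinom m := by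
  have h1 := sexticBinom_mul_factorials m
  have h2 := sexticBinom_mul_factorials (m + 1)
  simp only [show 6 * (m + 1) = 6 * m + 5 + 1 by ring, show 3 * (m + 1) = 3 * m + 2 + 1 by ring,
    show 2 * (m + 1) = 2 * m + 1 + 1 by ring, show 6 * m + 5 = 6 * m + 4 + 1 by ring,
    show 6 * m + 4 = 6 * m + 3 + 1 by ring, show 6 * m + 3 = 6 * m + 2 + 1 by ring,
    show 6 * m + 2 = 6 * m + 1 + 1 by ring, show 3 * m + 2 = 3 * m + 1 + 1 by ring,
    Nat.factorial_succ] at h2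
  rw [← h1] at h2
  have hpos : 0 < (3 * m).factorial * (2 * m).factorial * m.factorial *
      (6 * (m + 1) * (3 * m + 1) * (3 * m + 2) * (2 * m + 1)) := by positivity
  refine Nat.eq_of_mul_eq_mul_right hpos ?_
  linear_combination h2

theorem centralBinom_succ_mul (m : ℕ) :
    (m + 1) * (m + 1).centralBinom = 2 * (2 * m + 1) * m.centralBinom :=
  Nat.succ_mul_centralBinom_succ m

theorem sexticCubeBinom_succ (m : ℕ) :
    sexticCubeBinom (m + 1) * (m + 1) ^ 3 =
      24 * (6 * m + 1) * (6 * m + 5) * (2 * m + 1) * sexticCubeBinom m := by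
  have h1 := sexticBinom_succ m
  have h2 := centralBinom_succ_mul m
  calc _ = (sexticBinom (m + 1) * (m + 1) ^ 2) * ((m + 1) * (m + 1).centralBinom) := by
        rw [sexticCubeBinom]; ring
    _ = _ := by rw [h1, h2, sexticCubeBinom]; ring

/-! ### Clausen's formula for integral power series -/

section Clausen

open PowerSeries

/-- The generating series of `sexticBinom`. -/
noncomputable def sexticSeries : ℤ⟦X⟧ := PowerSeries.mk fun m => (sexticBinom m : ℤ)

/-- The polynomial `X (1 - 432 X)`, as a power series. -/
noncomputable def clausenArg : ℤ⟦X⟧ := X * (1 - 432 * X)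

theorem derivative_intCast_mul (c : ℤ) (f : ℤ⟦X⟧) : d⁄dX ℤ ((c : ℤ⟦X⟧) * f) = c * d⁄dX ℤ f := by
  have : (c : ℤ⟦X⟧) = C c := by simp
  rw [this, Derivation.leibniz]
  simp

theorem derivative_clausenArg : d⁄dX ℤ clausenArg = 1 - 864 * X := by
  have h : clausenArg = X - ((432 : ℤ) : ℤ⟦X⟧) * X ^ 2 := by rw [clausenArg]; push_cast; ring
  rw [h, map_sub, derivative_intCast_mul, derivative_pow, derivative_X]
  push_cast
  ring

theorem derivative_one_sub : d⁄dX ℤ (1 - 864 * X : ℤ⟦X⟧) = -864 := by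
  have h : (1 - 864 * X : ℤ⟦X⟧) = 1 - ((864 : ℤ) : ℤ⟦X⟧) * X := by push_cast; ring
  rw [h, map_sub, derivative_intCast_mul, derivative_X, derivative_one]
  push_cast
  ring

theorem coeff_intCast_mul (c : ℤ) (f : ℤ⟦X⟧) (n : ℕ) :
    coeff n ((c : ℤ⟦X⟧) * f) = c * coeff n f := by
  have : (c : ℤ⟦X⟧) = C c := by simp
  rw [this, coeff_C_mul]

theorem sexticSeries_ode :
    clausenArg * d⁄dX ℤ (d⁄dX ℤ sexticSeries) + (1 - 864 * X) * d⁄dX ℤ sexticSeries =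
      60 * sexticSeries := by
  set F := sexticSeries
  have h : clausenArg * d⁄dX ℤ (d⁄dX ℤ F) + (1 - 864 * X) * d⁄dX ℤ F - 60 * F =
      X * d⁄dX ℤ (d⁄dX ℤ F) + d⁄dX ℤ F - (((432 : ℤ) : ℤ⟦X⟧) * (X * (X * d⁄dX ℤ (d⁄dX ℤ F)))
      + ((864 : ℤ) : ℤ⟦X⟧) * (X * d⁄dX ℤ F) + ((60 : ℤ) : ℤ⟦X⟧) * F) := by
    rw [clausenArg]; push_cast; ring
  rw [← sub_eq_zero, h]
  ext n
  have hs : ∀ m : ℕ, (sexticBinom (m + 1) : ℤ) * (m + 1) ^ 2 =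
      12 * (6 * m + 1) * (6 * m + 5) * sexticBinom m := by
    intro m; exact_mod_cast sexticBinom_succ m
  have hF : ∀ m, coeff m F = (sexticBinom m : ℤ) := fun m => coeff_mk _ _
  simp only [map_sub, map_add, coeff_intCast_mul, map_zero]
  rcases n with _ | _ | n
  · simp only [coeff_zero_X_mul, coeff_derivative, hF]
    have := hs 0
    push_cast at this ⊢
    linarith
  · simp only [coeff_succ_X_mul, coeff_zero_X_mul, coeff_derivative, hF]
    have := hs 1
    push_cast at this ⊢
    linarith
  · simp only [coeff_succ_X_mul, coeff_derivative, hF]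
    have := hs (n + 2)
    push_cast at this ⊢
    linear_combination this

/-- `X` times the symmetric square of the differential operator that annihilates
`sexticSeries`. -/
noncomputable def symSqOperator (Y : ℤ⟦X⟧) : ℤ⟦X⟧ :=
  X * (clausenArg ^ 2 * d⁄dX ℤ (d⁄dX ℤ (d⁄dX ℤ Y))
    + 3 * clausenArg * (1 - 864 * X) * d⁄dX ℤ (d⁄dX ℤ Y)
    + ((1 - 864 * X) ^ 2 - 1104 * clausenArg) * d⁄dX ℤ Y - 120 * (1 - 864 * X) * Y)

theorem symSqOperator_add (Y Z : ℤ⟦X⟧) :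
    symSqOperator (Y + Z) = symSqOperator Y + symSqOperator Z := by
  simp only [symSqOperator, map_add]
  ring

theorem symSqOperator_sub (Y Z : ℤ⟦X⟧) :
    symSqOperator (Y - Z) = symSqOperator Y - symSqOperator Z := by
  simp only [symSqOperator, map_sub]
  ring

theorem symSqOperator_intCast_mul (c : ℤ) (Y : ℤ⟦X⟧) :
    symSqOperator (c * Y) = c * symSqOperator Y := by
  simp only [symSqOperator, derivative_intCast_mul]
  ring

theorem derivative_mul' (f g : ℤ⟦X⟧) : d⁄dX ℤ (f * g) = f * d⁄dX ℤ g + g * d⁄dX ℤ f := by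
  rw [Derivation.leibniz]; simp

theorem derivative_ofNat_mul (c : ℕ) [c.AtLeastTwo] (f : ℤ⟦X⟧) :
    d⁄dX ℤ ((OfNat.ofNat c : ℤ⟦X⟧) * f) = (OfNat.ofNat c : ℤ⟦X⟧) * d⁄dX ℤ f := by
  have := derivative_intCast_mul (OfNat.ofNat c : ℤ) f
  simpa using this

/-- If F solves a second-order linear equation, F² solves its symmetric square: the result is a
combination of the equation and its derivative. -/
theorem symSqOperator_sexticSeries_sq : symSqOperator (sexticSeries ^ 2) = 0 := by
  have h := sexticSeries_ode
  set F := sexticSeries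
  have h' := congrArg (d⁄dX ℤ) h
  rw [map_add, derivative_mul', derivative_mul', derivative_ofNat_mul, derivative_clausenArg,
    derivative_one_sub] at h'
  set F1 := d⁄dX ℤ F with hF1
  set F2 := d⁄dX ℤ F1 with hF2
  set F3 := d⁄dX ℤ F2 with hF3
  have e1 : d⁄dX ℤ (F ^ 2) = 2 * (F * F1) := by rw [pow_two, derivative_mul']; ring
  have e2 : d⁄dX ℤ (d⁄dX ℤ (F ^ 2)) = 2 * (F * F2 + F1 * F1) := by
    rw [e1, derivative_ofNat_mul, derivative_mul']
  have e3 : d⁄dX ℤ (d⁄dX ℤ (d⁄dX ℤ (F ^ 2))) = 2 * (F * F3 + 3 * F1 * F2) := by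
    rw [e2, derivative_ofNat_mul, map_add, derivative_mul', derivative_mul']; ring
  rw [symSqOperator, e3, e2, e1]
  linear_combination X * (2 * clausenArg * F * h' +
    (6 * clausenArg * F1 + 2 * (1 - 864 * X) * F) * h)

theorem symSqOperator_one : symSqOperator 1 = -(X * (1 - 864 * X)) * 120 := by
  simp only [symSqOperator, derivative_one, map_zero]
  ring

theorem derivative_clausenArg_pow (n : ℕ) :
    d⁄dX ℤ (clausenArg ^ (n + 1)) =
      ((n + 1 : ℤ) : ℤ⟦X⟧) * (clausenArg ^ n * (1 - 864 * X)) := by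
  rw [derivative_pow, derivative_clausenArg]
  push_cast
  ring

/-- With u = X(1 - 432X) one has (1 - 864X)² = 1 - 1728u, so, up to the common factor X(1 - 864X),
only two consecutive powers of u survive. Their coefficients are those of the recurrence
`sexticCubeBinom_succ`. -/
theorem symSqOperator_clausenArg_pow (m : ℕ) :
    symSqOperator (clausenArg ^ (m + 1)) = X * (1 - 864 * X) *
      (((m : ℤ⟦X⟧) + 1) ^ 3 * clausenArg ^ m
        - 24 * (6 * ((m : ℤ⟦X⟧) + 1) + 1) * (6 * ((m : ℤ⟦X⟧) + 1) + 5) *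
          (2 * ((m : ℤ⟦X⟧) + 1) + 1) * clausenArg ^ (m + 1)) := by
  have hv : (1 - 864 * X : ℤ⟦X⟧) ^ 2 = 1 - 1728 * clausenArg := by rw [clausenArg]; ring
  have hd := derivative_one_sub
  have hm := derivative_clausenArg_pow
  have h0 : d⁄dX ℤ clausenArg = 1 - 864 * X := derivative_clausenArg
  have hc : d⁄dX ℤ (-864 : ℤ⟦X⟧) = 0 := by
    have : (-864 : ℤ⟦X⟧) = C (-864) := by simp
    rw [this, derivative_C]
  have hi : ∀ c : ℤ, d⁄dX ℤ (c : ℤ⟦X⟧) = 0 := by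
    intro c
    have : (c : ℤ⟦X⟧) = C c := by simp
    rw [this, derivative_C]
  rw [symSqOperator]
  set u := clausenArg
  set v : ℤ⟦X⟧ := 1 - 864 * X
  rcases m with _ | _ | m
  · simp only [zero_add, pow_one, h0, hd, hc, pow_zero, Nat.cast_zero]
    linear_combination X * v * hv
  · simp only [hm, derivative_mul', hd, hi, map_add, zero_add, pow_one, h0, mul_zero, add_zero, hc]
    push_cast
    linear_combination (X * v * u * 8) * hv
  · simp only [hm, derivative_mul', hd, hi, map_add, mul_zero, add_zero, hc]
    push_cast
    linear_combination (X * v * u ^ (m + 2) * ((m : ℤ⟦X⟧) + 3) ^ 3) * hv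

/-- The recurrence makes the sum telescope, leaving a boundary term divisible by X^(N+1). -/
theorem symSqOperator_sum (N : ℕ) :
    symSqOperator (∑ m ∈ Finset.range (N + 1), ((sexticCubeBinom m : ℤ) : ℤ⟦X⟧) * clausenArg ^ m) =
      -(X * (1 - 864 * X)) * ((((sexticCubeBinom (N + 1) : ℤ) * (N + 1) ^ 3 : ℤ) : ℤ⟦X⟧) *
        clausenArg ^ N) := by
  induction N with
  | zero =>
    have : sexticCubeBinom 1 = 120 := by decide
    have h0 : sexticCubeBinom 0 = 1 := by decide
    simp [symSqOperator_one, this, h0]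
  | succ N ih =>
    have hs : ((sexticCubeBinom (N + 1 + 1) : ℤ) * ((N + 1 : ℕ) + 1) ^ 3 : ℤ) =
      24 * (6 * (N + 1) + 1) * (6 * (N + 1) + 5) * (2 * (N + 1) + 1) * sexticCubeBinom (N + 1) := by
      exact_mod_cast sexticCubeBinom_succ (N + 1)
    rw [Finset.sum_range_succ, symSqOperator_add, ih, symSqOperator_intCast_mul,
      symSqOperator_clausenArg_pow, hs]
    push_cast
    ring

theorem coeff_mul_of_lt {R : Type*} [CommSemiring R] (A B : R⟦X⟧) (k : ℕ)
    (h : ∀ i < k, coeff i B = 0) : coeff k (A * B) = constantCoeff A * coeff k B := by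
  rw [coeff_mul, Finset.sum_eq_single (0, k)]
  · simp
  · rintro ⟨i, j⟩ hij hne
    have hij : i + j = k := by simpa using hij
    have : j < k := by
      rcases Nat.eq_zero_or_pos i with rfl | hi
      · exact absurd (by simpa using hij : (0, j) = (0, k)) hne
      · lia
    rw [h j this, mul_zero]
  · simp

theorem coeff_X_mul_derivative (Y : ℤ⟦X⟧) (k : ℕ) : coeff k (X * d⁄dX ℤ Y) = k * coeff k Y := by
  cases k with
  | zero => simp
  | succ k => rw [coeff_succ_X_mul, coeff_derivative]; push_cast; ring

/-- The indicial polynomial at 0 is k(k-1)(k-2) + 3k(k-1) + k = k³. A series killed to order k is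
thus determined, up to that order, by its constant term. -/
theorem coeff_symSqOperator (Y : ℤ⟦X⟧) (k : ℕ) (h : ∀ i < k, coeff i Y = 0) :
    coeff k (symSqOperator Y) = k ^ 3 * coeff k Y := by
  have e : symSqOperator Y = (1 - 432 * X) ^ 2 * (X ^ 3 * d⁄dX ℤ (d⁄dX ℤ (d⁄dX ℤ Y)))
      + 3 * (1 - 432 * X) * (1 - 864 * X) * (X ^ 2 * d⁄dX ℤ (d⁄dX ℤ Y))
      + ((1 - 864 * X) ^ 2 - 1104 * clausenArg) * (X * d⁄dX ℤ Y) +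
      (- (120 * (1 - 864 * X) * X)) * Y := by
    rw [symSqOperator, clausenArg]; ring
  have c1 := coeff_X_mul_derivative Y
  have c2 : ∀ i, coeff i (X ^ 2 * d⁄dX ℤ (d⁄dX ℤ Y)) = (i * (i - 1) : ℤ) * coeff i Y := by
    rintro (_ | _ | i)
    · simp [coeff_X_pow_mul']
    · simp [coeff_X_pow_mul']
    · rw [show i + 1 + 1 = i + 2 by rfl, coeff_X_pow_mul, coeff_derivative, coeff_derivative]
      push_cast; ring
  have c3 : ∀ i, coeff i (X ^ 3 * d⁄dX ℤ (d⁄dX ℤ (d⁄dX ℤ Y))) =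
      (i * (i - 1) * (i - 2) : ℤ) * coeff i Y := by
    rintro (_ | _ | _ | i)
    · simp [coeff_X_pow_mul']
    · simp [coeff_X_pow_mul']
    · simp [coeff_X_pow_mul']
    · rw [show i + 1 + 1 + 1 = i + 3 by rfl, coeff_X_pow_mul, coeff_derivative, coeff_derivative,
        coeff_derivative]
      push_cast; ring
  rw [e, map_add, map_add, map_add, coeff_mul_of_lt _ (X ^ 3 * _) k,
    coeff_mul_of_lt _ (X ^ 2 * _) k, coeff_mul_of_lt _ (X * _) k, coeff_mul_of_lt _ _ k h, c1, c2,
    c3]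
  · simp [clausenArg, map_ofNat]; ring
  all_goals
    intro i hi
    simp only [c1, c2, c3, h i hi, mul_zero]

/-- **Clausen's formula**, truncated. -/
theorem coeff_sexticSeries_sq (N k : ℕ) (hk : k < N) :
    coeff k (sexticSeries ^ 2) =
      coeff k (∑ m ∈ Finset.range N, ((sexticCubeBinom m : ℤ) : ℤ⟦X⟧) * clausenArg ^ m) := by
  obtain ⟨N, rfl⟩ : ∃ M, N = M + 1 := ⟨N - 1, by lia⟩
  induction k using Nat.strong_induction_on with
  | _ k ih =>
  rw [← sub_eq_zero, ← map_sub]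
  set S := ∑ m ∈ Finset.range (N + 1), ((sexticCubeBinom m : ℤ) : ℤ⟦X⟧) * clausenArg ^ m with hS
  have hlow : ∀ i < k, coeff i (sexticSeries ^ 2 - S) = 0 := by
    intro i hi
    rw [map_sub, ih i hi (by lia), sub_self]
  rcases Nat.eq_zero_or_pos k with rfl | hpos
  · have h0 : sexticCubeBinom 0 = 1 := by decide
    have h1 : constantCoeff sexticSeries = 1 := by
      rw [← coeff_zero_eq_constantCoeff_apply, sexticSeries, coeff_mk]; decide
    simp [hS, Finset.sum_range_succ', clausenArg, h0, h1]
  · have h := coeff_symSqOperator _ k hlow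
    rw [symSqOperator_sub, symSqOperator_sexticSeries_sq, symSqOperator_sum, zero_sub] at h
    have hz : coeff k (-(-(X * (1 - 864 * X)) * ((((sexticCubeBinom (N + 1) : ℤ) * (N + 1) ^ 3 : ℤ)
        : ℤ⟦X⟧) * clausenArg ^ N))) = 0 := by
      have : X ^ (N + 1) ∣ (-(-(X * (1 - 864 * X)) * ((((sexticCubeBinom (N + 1) : ℤ) *
          (N + 1) ^ 3 : ℤ) : ℤ⟦X⟧) * clausenArg ^ N))) := by
        rw [clausenArg, mul_pow]
        refine ⟨(1 - 864 * X) * (((sexticCubeBinom (N + 1) : ℤ) * (N + 1) ^ 3 : ℤ) : ℤ⟦X⟧) *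
          (1 - 432 * X) ^ N, ?_⟩
        ring
      exact X_pow_dvd_iff.mp this k hk
    rw [hz] at h
    have : (k : ℤ) ^ 3 ≠ 0 := by positivity
    exact (mul_eq_zero.mp h.symm).resolve_left this

end Clausen

/-! ### Divisibility of binomial coefficients by p -/

/-- Kummer's theorem: the hypothesis forces a carry out of the lowest f digits when b and a - b are
added in base p. -/
theorem dvd_choose_of_mod_lt {p f a b : ℕ} (hp : p.Prime) (h : a % p ^ f < b % p ^ f) :
    p ∣ a.choose b := by
  rcases lt_or_ge a b with hab | hab
  · rw [Nat.choose_eq_zero_of_lt hab]; exact dvd_zero p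
  have hf : f ≠ 0 := by rintro rfl; simp [Nat.mod_one] at h
  have hle : p ^ f ≤ a := by
    by_contra hlt
    push Not at hlt
    rw [Nat.mod_eq_of_lt hlt, Nat.mod_eq_of_lt (hab.trans_lt hlt)] at h
    lia
  have ha : a ≠ 0 := by
    have := Nat.pow_pos (n := f) hp.pos
    lia
  apply Nat.dvd_of_factorization_pos
  rw [Nat.factorization_choose hp hab (Nat.lt_succ_self _)]
  refine (Finset.card_pos.mpr ⟨f, ?_⟩).ne'
  rw [Finset.mem_filter, Finset.mem_Ico]
  refine ⟨⟨by lia, Nat.lt_succ_of_le (Nat.le_log_of_pow_le hp.one_lt hle)⟩, ?_⟩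
  by_contra hlt
  push Not at hlt
  have : a % p ^ f = b % p ^ f + (a - b) % p ^ f := by
    conv_lhs => rw [← Nat.add_sub_of_le hab]
    rw [Nat.add_mod, Nat.mod_eq_of_lt hlt]
  lia

theorem mod_eq_of_eq_add {x q c r : ℕ} (h : x = c * q + r) (hr : r < q) : x % q = r := by
  rw [h, Nat.mul_add_mod_self_right, Nat.mod_eq_of_lt hr]

theorem dvd_sexticBinom {p f m : ℕ} (hp : p.Prime) (h2 : p ≠ 2) (h3 : p ≠ 3)
    (hlo : p ^ f ≤ 6 * m) (hhi : m < p ^ f) : p ∣ sexticBinom m := by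
  have hf : f ≠ 0 := by rintro rfl; simp at hhi; lia
  have hc2 : ¬ 2 ∣ p ^ f := fun h => h2 ((Nat.prime_dvd_prime_iff_eq Nat.prime_two hp).mp
    (Nat.prime_two.dvd_of_dvd_pow h)).symm
  have hc3 : ¬ 3 ∣ p ^ f := fun h => h3 ((Nat.prime_dvd_prime_iff_eq Nat.prime_three hp).mp
    (Nat.prime_three.dvd_of_dvd_pow h)).symm
  rw [sexticBinom]
  -- Split m/p^f at 1/3, 1/2 and 2/3; on each interval one of the two binomial factors has a carry.
  rcases lt_or_ge (3 * m) (p ^ f) with h | h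
  · refine Dvd.dvd.mul_right (dvd_choose_of_mod_lt (f := f) hp ?_) _
    rw [mod_eq_of_eq_add (x := 6 * m) (c := 1) (r := 6 * m - p ^ f) (by lia) (by lia),
      Nat.mod_eq_of_lt h]
    lia
  rcases lt_or_ge (2 * m) (p ^ f) with h' | h'
  · refine Dvd.dvd.mul_left (dvd_choose_of_mod_lt (f := f) hp ?_) _
    rw [mod_eq_of_eq_add (x := 3 * m) (c := 1) (r := 3 * m - p ^ f) (by lia) (by lia),
      Nat.mod_eq_of_lt hhi]
    lia
  rcases lt_or_ge (3 * m) (2 * p ^ f) with h'' | h''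
  · refine Dvd.dvd.mul_right (dvd_choose_of_mod_lt (f := f) hp ?_) _
    rw [mod_eq_of_eq_add (x := 6 * m) (c := 3) (r := 6 * m - 3 * p ^ f) (by lia) (by lia),
      mod_eq_of_eq_add (x := 3 * m) (c := 1) (r := 3 * m - p ^ f) (by lia) (by lia)]
    lia
  · refine Dvd.dvd.mul_left (dvd_choose_of_mod_lt (f := f) hp ?_) _
    rw [mod_eq_of_eq_add (x := 3 * m) (c := 2) (r := 3 * m - 2 * p ^ f) (by lia) (by lia),
      Nat.mod_eq_of_lt hhi]
    lia

/-! ### Central binomial coefficients modulo p -/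

section CentralBinom

open PowerSeries

/-- The series is (1 - 4X)^(-1/2): its equation (1 - 4X)B' = 2B makes the derivative of the left
side vanish. -/
theorem centralBinomSeries_sq :
    (PowerSeries.mk fun m => (m.centralBinom : ℤ)) ^ 2 * (1 - 4 * X) = 1 := by
  set B : ℤ⟦X⟧ := PowerSeries.mk fun m => (m.centralBinom : ℤ) with hB
  have e : (1 - 4 * X : ℤ⟦X⟧) = 1 - ((4 : ℤ) : ℤ⟦X⟧) * X := by push_cast; rfl
  have ode : (1 - 4 * X) * d⁄dX ℤ B = 2 * B := by
    have h : (1 - 4 * X) * d⁄dX ℤ B - 2 * B =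
        d⁄dX ℤ B - (((4 : ℤ) : ℤ⟦X⟧) * (X * d⁄dX ℤ B) + ((2 : ℤ) : ℤ⟦X⟧) * B) := by
      push_cast; ring
    rw [← sub_eq_zero, h]
    ext n
    have hs : ((n : ℤ) + 1) * (n + 1).centralBinom = 2 * (2 * n + 1) * n.centralBinom := by
      exact_mod_cast centralBinom_succ_mul n
    simp only [map_sub, map_add, coeff_intCast_mul, coeff_X_mul_derivative, coeff_derivative,
      hB, coeff_mk, map_zero]
    linear_combination hs
  have hd : d⁄dX ℤ (1 - 4 * X : ℤ⟦X⟧) = -4 := by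
    rw [e, map_sub, derivative_intCast_mul, derivative_X, derivative_one]
    push_cast
    ring
  apply derivative.ext
  · rw [derivative_mul', derivative_pow, hd, derivative_one]
    push_cast
    linear_combination 2 * B * ode
  · have : constantCoeff B = 1 := by
      rw [← coeff_zero_eq_constantCoeff_apply, hB, coeff_mk, Nat.centralBinom_zero, Nat.cast_one]
    simp [this]

variable {K : Type*} [Field K] {p : ℕ} [Fact p.Prime] [CharP K p]

theorem natCast_pow_char_pow (f c : ℕ) : (c : K) ^ p ^ f = c := by
  have := map_natCast (iterateFrobenius K p f) c
  rwa [iterateFrobenius_def] at this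

/-- Modulo X^q, with q = p^f, both (1 - 4X)^n and the central binomial series are square roots of
1/(1 - 4X) with constant term 1, since (1 - 4X)^q = 1 - 4X^q. As 2 is invertible, they agree below
degree q. -/
theorem choose_mul_pow_eq_centralBinom (h2 : (2 : K) ≠ 0) {f n k : ℕ} (hn : p ^ f = 2 * n + 1)
    (hk : k < p ^ f) : (n.choose k : K) * (-4) ^ k = k.centralBinom := by
  have hB : (PowerSeries.mk fun m => (m.centralBinom : K)) ^ 2 * (1 - 4 * X) = 1 := by
    have h := congrArg (PowerSeries.map (Int.castRingHom K)) centralBinomSeries_sq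
    have hmap : PowerSeries.map (Int.castRingHom K) (PowerSeries.mk fun m => (m.centralBinom : ℤ)) =
        PowerSeries.mk fun m => (m.centralBinom : K) := by
      ext m; simp
    simpa [hmap, map_ofNat] using h
  set B : K⟦X⟧ := PowerSeries.mk fun m => (m.centralBinom : K) with hBdef
  set P : K⟦X⟧ := (1 - 4 * X) ^ n with hP
  have hP2 : P ^ 2 * (1 - 4 * X) = 1 - 4 * X ^ p ^ f := by
    have : CharP K⟦X⟧ p := by
      have := charP_of_injective_algebraMap (R := K) (A := K⟦X⟧)
        (FaithfulSMul.algebraMap_injective K K⟦X⟧) p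
      exact this
    rw [hP, ← pow_mul, ← pow_succ, mul_comm n 2, ← hn, sub_pow_char_pow, one_pow, mul_pow]
    have h4 := natCast_pow_char_pow (K := K) (p := p) f 4
    have : (4 : K⟦X⟧) ^ p ^ f = 4 := by
      have e : (4 : K⟦X⟧) = C (4 : K) := by rw [map_ofNat]
      rw [e, ← map_pow]
      exact congrArg C (by exact_mod_cast h4)
    rw [this]
  have hdvd : X ^ p ^ f ∣ (P - B) * (P + B) := by
    refine ⟨-4 * B ^ 2, ?_⟩
    linear_combination B ^ 2 * hP2 - P ^ 2 * hB
  have hunit : IsUnit (P + B) := by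
    rw [PowerSeries.isUnit_iff_constantCoeff]
    have : constantCoeff (P + B) = 2 := by
      have : constantCoeff B = 1 := by
        rw [← coeff_zero_eq_constantCoeff_apply, hBdef, coeff_mk, Nat.centralBinom_zero,
          Nat.cast_one]
      rw [map_add, this, hP]
      simp
      norm_num
    rw [this]
    exact h2.isUnit
  have hPB := X_pow_dvd_iff.mp (hunit.dvd_mul_right.mp hdvd) k hk
  rw [map_sub, sub_eq_zero, hBdef, coeff_mk] at hPB
  rw [← hPB, hP]
  have : (1 - 4 * X : K⟦X⟧) = ((1 + Polynomial.C (-4 : K) * Polynomial.X : Polynomial K) : K⟦X⟧) := by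
    have h4 : (4 : K⟦X⟧) = C (4 : K) := by rw [map_ofNat]
    simp [sub_eq_add_neg, h4]
  rw [this, ← Polynomial.coe_pow, Polynomial.coeff_coe, add_comm, add_pow, Polynomial.finsetSum_coeff]
  simp only [one_pow, mul_one, mul_pow, ← Polynomial.C_pow]
  have hterm : ∀ i, (Polynomial.C ((-4 : K) ^ i) * Polynomial.X ^ i * ((n.choose i : ℕ) : Polynomial K)).coeff k
      = if i = k then (n.choose k : K) * (-4) ^ k else 0 := by
    intro i
    rw [Polynomial.coeff_mul_natCast, Polynomial.coeff_C_mul_X_pow]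
    by_cases hik : k = i
    · subst hik; simp [mul_comm]
    · rw [if_neg hik, if_neg (Ne.symm hik), zero_mul]
  simp only [hterm]
  rw [Finset.sum_ite_eq']
  split_ifs with h
  · rfl
  · rw [Nat.choose_eq_zero_of_lt (by simpa using h)]; simp

end CentralBinom

/-! ### The Hasse invariant of the trinomial 4X³ + X² - 4s -/

section Hasse

open Polynomial

variable {K : Type*} [Field K] {p : ℕ} [Fact p.Prime] [CharP K p]

theorem coeff_trinomial_pow (n : ℕ) (s : K) :
    ((4 * X ^ 3 + X ^ 2 + C s : K[X]) ^ n).coeff (2 * n) =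
      ∑ k ∈ Finset.range (n + 1), (n.choose k : K) *
        (if 3 ∣ k then (k.choose (k / 3) : K) * (16 * s) ^ (k / 3) else 0) := by
  have e : (4 * X ^ 3 + X ^ 2 + C s : K[X]) = (C 4 * X ^ 3 + C s) + X ^ 2 := by
    rw [map_ofNat]; ring
  rw [e, add_pow, finsetSum_coeff]
  refine Finset.sum_congr rfl fun k hk => ?_
  have hk' : k ≤ n := by simpa [Nat.lt_succ_iff] using hk
  rw [coeff_mul_natCast, ← pow_mul, mul_comm]
  congr 1
  -- The remaining k factors must supply X^(2k) from 4X³ and s, so exactly k/3 of them contribute s.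
  rw [show 2 * n = 2 * k + 2 * (n - k) by lia, coeff_mul_X_pow, add_comm (C 4 * X ^ 3) (C s), add_pow,
    finsetSum_coeff]
  have hterm : ∀ i, (C s ^ i * (C 4 * X ^ 3) ^ (k - i) * ((k.choose i : ℕ) : K[X])).coeff (2 * k) =
      if 2 * k = 3 * (k - i) then (k.choose i : K) * (s ^ i * 4 ^ (k - i)) else 0 := by
    intro i
    rw [coeff_mul_natCast, mul_pow, ← pow_mul, ← C_pow, ← C_pow, ← mul_assoc, ← C_mul,
      coeff_C_mul_X_pow]
    split_ifs <;> simp [mul_comm]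
  simp only [hterm]
  split_ifs with h
  · obtain ⟨l, rfl⟩ := h
    rw [Finset.sum_eq_single l]
    · rw [if_pos (by lia), Nat.mul_div_cancel_left _ (by norm_num), show 3 * l - l = 2 * l by lia,
        pow_mul, mul_pow, show (4 : K) ^ 2 = 16 by norm_num, mul_comm (s ^ l)]
    · intro i hi hne
      rw [if_neg]
      simp at hi
      lia
    · intro hl
      simp at hl
      lia
  · refine Finset.sum_eq_zero fun i hi => if_neg ?_
    simp at hi
    lia

theorem natCast_sexticBinom_eq_zero (h2 : (2 : K) ≠ 0) (h3 : (3 : K) ≠ 0) {f m : ℕ}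
    (hlo : p ^ f ≤ 6 * m) (hhi : m < p ^ f) : (sexticBinom m : K) = 0 := by
  rw [CharP.cast_eq_zero_iff K p]
  refine dvd_sexticBinom Fact.out ?_ ?_ hlo hhi
  · rintro rfl; exact h2 (by exact_mod_cast CharP.cast_eq_zero K 2)
  · rintro rfl; exact h3 (by exact_mod_cast CharP.cast_eq_zero K 3)

theorem coeff_trinomial_pow_eq_sum (h2 : (2 : K) ≠ 0) (h3 : (3 : K) ≠ 0) {f n : ℕ}
    (hn : p ^ f = 2 * n + 1) (s : K) :
    ((4 * X ^ 3 + X ^ 2 + C (-(4 * s)) : K[X]) ^ n).coeff (2 * n) =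
      ∑ l ∈ Finset.range (p ^ f), (sexticBinom l : K) * s ^ l := by
  rw [coeff_trinomial_pow]
  have h4 : (-4 : K) ≠ 0 := by
    have : (-4 : K) = -(2 * 2) := by norm_num
    rw [this]; exact neg_ne_zero.mpr (mul_ne_zero h2 h2)
  have key : ∀ l, 3 * l < p ^ f → (n.choose (3 * l) : K) * (((3 * l).choose l : K) *
      (16 * -(4 * s)) ^ l) = (sexticBinom l : K) * s ^ l := by
    intro l hl
    have h := choose_mul_pow_eq_centralBinom h2 hn hl
    rw [Nat.centralBinom_eq_two_mul_choose, show 2 * (3 * l) = 6 * l by ring, pow_mul] at h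
    rw [sexticBinom, Nat.cast_mul, ← h, show (16 * -(4 * s) : K) = (-4) ^ 3 * s by ring, mul_pow]
    ring
  have hsub : Finset.range (n / 3 + 1) ⊆ Finset.range (p ^ f) := by
    intro l; simp only [Finset.mem_range]; lia
  -- For l > n/3 one has 6l > p^f, so the added terms vanish modulo p.
  rw [← Finset.sum_subset hsub]
  · symm
    refine Finset.sum_of_injOn (fun l => 3 * l) (fun a _ b _ h => by simpa using h) ?_ ?_ ?_
    · intro l hl
      simp at hl ⊢
      lia
    · intro k hk hk'
      rw [if_neg, mul_zero]
      rintro ⟨l, rfl⟩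
      apply hk'
      simp at hk ⊢
      lia
    · intro l hl
      simp at hl
      simp only [dvd_mul_right, if_true, Nat.mul_div_cancel_left _ (show 0 < 3 by norm_num)]
      exact (key l (by lia)).symm
  · intro l hl hl'
    simp at hl hl'
    rw [natCast_sexticBinom_eq_zero (p := p) h2 h3 (by lia) hl, zero_mul]

/-- Clausen's formula for the truncations in characteristic `p`. -/
theorem sum_sexticBinom_sq (h2 : (2 : K) ≠ 0) (h3 : (3 : K) ≠ 0) (f : ℕ) (s : K) :
    (∑ l ∈ Finset.range (p ^ f), (sexticBinom l : K) * s ^ l) ^ 2 =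
      ∑ m ∈ Finset.range (p ^ f), (sexticCubeBinom m : K) * (s * (1 - 432 * s)) ^ m := by
  set q := p ^ f with hq
  have hq0 : 0 < q := Nat.pow_pos (Fact.out : p.Prime).pos
  let P : ℤ[X] := ∑ l ∈ Finset.range q, (sexticBinom l : ℤ[X]) * X ^ l
  let Q : ℤ[X] := ∑ m ∈ Finset.range q, (sexticCubeBinom m : ℤ[X]) * (X * (1 - 432 * X)) ^ m
  have hcoeff : ∀ k < q, (P ^ 2).coeff k = Q.coeff k := by
    intro k hk
    have hQ : (Q : PowerSeries ℤ) = ∑ m ∈ Finset.range q,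
        ((sexticCubeBinom m : ℤ) : PowerSeries ℤ) * clausenArg ^ m := by
      simp only [Q, clausenArg]
      rw [← Polynomial.coeToPowerSeries.ringHom_apply, map_sum]
      refine Finset.sum_congr rfl fun m _ => ?_
      rw [map_mul, map_natCast, map_pow, map_mul, map_sub, map_mul,
        map_ofNat Polynomial.coeToPowerSeries.ringHom 432, map_one]
      simp
    have hP : P = PowerSeries.trunc q sexticSeries := by
      ext i
      simp only [P, PowerSeries.coeff_trunc, finsetSum_coeff, coeff_natCast_mul, coeff_X_pow,
        sexticSeries, PowerSeries.coeff_mk]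
      simp
    have h := coeff_sexticSeries_sq q k hk
    rw [← hQ, Polynomial.coeff_coe, pow_two, PowerSeries.coeff_mul_eq_coeff_trunc_mul_trunc _ _ hk,
      ← hP] at h
    rw [← h, pow_two, ← Polynomial.coe_mul, Polynomial.coeff_coe]
  have hvan : ∀ m, m ∈ Finset.range q → m ∉ Finset.range (q / 6 + 1) → (sexticBinom m : K) = 0 := by
    intro m hm hm'
    simp at hm hm'
    exact natCast_sexticBinom_eq_zero (p := p) (f := f) h2 h3 (by lia) hm
  have hsub : Finset.range (q / 6 + 1) ⊆ Finset.range q := by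
    intro l; simp only [Finset.mem_range]; lia
  have hPm : P.map (Int.castRingHom K) =
      ∑ l ∈ Finset.range (q / 6 + 1), (sexticBinom l : K[X]) * X ^ l := by
    simp only [P, Polynomial.map_sum]
    rw [Finset.sum_subset hsub]
    · simp
    · intro m hm hm'
      have := hvan m hm hm'
      rw [← Polynomial.C_eq_natCast, this]; simp
  have hQm : Q.map (Int.castRingHom K) =
      ∑ l ∈ Finset.range (q / 6 + 1), (sexticCubeBinom l : K[X]) * (X * (1 - 432 * X)) ^ l := by
    simp only [Q, Polynomial.map_sum]
    rw [Finset.sum_subset hsub]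
    · simp
    · intro m hm hm'
      have := hvan m hm hm'
      rw [← Polynomial.C_eq_natCast, sexticCubeBinom, Nat.cast_mul, this]; simp
  have hPd : (P.map (Int.castRingHom K)).natDegree ≤ q / 6 := by
    rw [hPm]
    refine natDegree_sum_le_of_forall_le _ _ fun l hl => ?_
    simp at hl
    rw [← Polynomial.C_eq_natCast]
    exact (natDegree_C_mul_X_pow_le _ _).trans (by lia)
  have hQd : (Q.map (Int.castRingHom K)).natDegree ≤ 2 * (q / 6) := by
    rw [hQm]
    refine natDegree_sum_le_of_forall_le _ _ fun l hl => ?_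
    simp at hl
    rw [← Polynomial.C_eq_natCast]
    refine (natDegree_C_mul_le _ _).trans (natDegree_pow_le.trans ?_)
    have : (X * (1 - 432 * X) : K[X]).natDegree ≤ 2 := by
      have : (X * (1 - 432 * X) : K[X]) = C (-432) * X ^ 2 + X := by
        rw [C_neg, map_ofNat]; ring
      rw [this]
      compute_degree
    nlinarith
  -- Clausen's formula gives the coefficients below q; both sides have degree at most 2(q/6) < q, so
  -- nothing else remains.
  have hEq : (P.map (Int.castRingHom K)) ^ 2 = Q.map (Int.castRingHom K) := by
    ext k
    rcases lt_or_ge k q with hk | hk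
    · rw [← Polynomial.map_pow, coeff_map, coeff_map, hcoeff k hk]
    · rw [coeff_eq_zero_of_natDegree_lt, coeff_eq_zero_of_natDegree_lt]
      · lia
      · refine (natDegree_pow_le (n := 2)).trans_lt ?_
        lia
  have := congrArg (eval s) hEq
  simpa [P, Q, Polynomial.map_sum, eval_finsetSum] using this

end Hasse

/-! ### Point counts over a finite field -/

section PointCount

open Polynomial

variable {F : Type*} [Field F] [Fintype F]

theorem ringChar_ne_two {K : Type*} [Field K] (h2 : (2 : K) ≠ 0) : ringChar K ≠ 2 := by
  intro h
  have := ringChar.Nat.cast_ringChar (R := K)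
  rw [h] at this
  exact h2 (by exact_mod_cast this)

/-- For i < 2(q-1), the power sum of x^i over the field is -1 if i = q-1 and 0 otherwise; the bound
excludes the next exceptional exponent 2(q-1). -/
theorem sum_eval_eq_neg_coeff (g : F[X]) (hg : g.natDegree < 2 * (Fintype.card F - 1)) :
    ∑ x, g.eval x = -g.coeff (Fintype.card F - 1) := by
  classical
  set q := Fintype.card F with hq
  have hq1 : 1 < q := Fintype.one_lt_card
  have hpow : ∀ i < 2 * (q - 1), ∑ x : F, x ^ i = if i = q - 1 then -1 else 0 := by
    intro i hi
    rcases lt_or_ge i (q - 1) with h | h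
    · rw [if_neg h.ne, FiniteField.sum_pow_lt_card_sub_one F i h]
    have hne : ∀ x : F, x ^ (q - 1) = if x = 0 then 0 else 1 := by
      intro x
      split_ifs with hx
      · rw [hx, zero_pow (by lia)]
      · exact FiniteField.pow_card_sub_one_eq_one x hx
    split_ifs with h'
    · subst h'
      simp only [hne]
      have : ∀ x : F, (if x = 0 then (0 : F) else 1) = 1 - if x = 0 then 1 else 0 := by
        intro x; split_ifs <;> simp
      have hq0 : (q : F) = 0 := FiniteField.cast_card_eq_zero F
      simp [this, Finset.sum_sub_distrib, ← hq, hq0]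
    · have : ∀ x : F, x ^ i = x ^ (i - (q - 1)) := by
        intro x
        conv_lhs => rw [show i = (i - (q - 1)) + (q - 1) by lia, pow_add, hne]
        split_ifs with hx
        · rw [hx, zero_pow (by lia), zero_mul]
        · rw [mul_one]
      simp only [this]
      exact FiniteField.sum_pow_lt_card_sub_one F _ (by lia)
  simp only [eval_eq_sum_range' hg]
  rw [Finset.sum_comm]
  simp only [← Finset.mul_sum]
  rw [Finset.sum_congr rfl fun i hi => by rw [hpow i (Finset.mem_range.mp hi)]]
  simp only [mul_ite, mul_neg, mul_one, mul_zero]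
  rw [Finset.sum_ite_eq', if_pos (by simp; lia)]

/-- Completing the square with z = 2y + a₁x + a₃ identifies affine points with solutions of z² =
`Ψ₂Sq`(x). -/
theorem card_point_eq_one_add_sum [DecidableEq F] (h2 : (2 : F) ≠ 0) (W : WeierstrassCurve F)
    [W.IsElliptic] :
    (Nat.card W.toAffine.Point : ℤ) =
      1 + ∑ x : F, (quadraticChar F (W.Ψ₂Sq.eval x) + 1) := by
  have hchar : ringChar F ≠ 2 := ringChar_ne_two h2
  let e : W.toAffine.Point ≃ Option (Σ x : F, {z : F // z ^ 2 = W.Ψ₂Sq.eval x}) :=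
    { toFun
        | .zero => none
        | .some x y h => some ⟨x, 2 * y + W.a₁ * x + W.a₃, by
            have := (W.toAffine.equation_iff x y).mp h.1
            simp only [WeierstrassCurve.Ψ₂Sq, WeierstrassCurve.b₂, WeierstrassCurve.b₄,
              WeierstrassCurve.b₆, eval_add, eval_mul, eval_C, eval_pow, eval_X]
            linear_combination 4 * this⟩
      invFun
        | none => .zero
        | some ⟨x, z, hz⟩ => .some x ((z - W.a₁ * x - W.a₃) / 2) <| by
            rw [← WeierstrassCurve.Affine.equation_iff_nonsingular,
              WeierstrassCurve.Affine.equation_iff]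
            simp only [WeierstrassCurve.Ψ₂Sq, WeierstrassCurve.b₂, WeierstrassCurve.b₄,
              WeierstrassCurve.b₆, eval_add, eval_mul, eval_C, eval_pow, eval_X] at hz
            field_simp
            linear_combination hz
      left_inv := by
        rintro (_ | ⟨x, y, h⟩)
        · rfl
        · simp only [WeierstrassCurve.Affine.Point.some.injEq, true_and]
          field_simp
          ring
      right_inv := by
        rintro (_ | ⟨x, z, hz⟩)
        · rfl
        · simp only [Option.some.injEq, Sigma.mk.injEq, heq_eq_eq, true_and, Subtype.mk.injEq]
          field_simp
          ring }
  rw [Nat.card_congr e, Nat.card_eq_fintype_card, Fintype.card_option, Fintype.card_sigma]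
  push_cast
  rw [add_comm]
  congr 1
  refine Finset.sum_congr rfl fun x _ => ?_
  rw [← quadraticChar_card_sqrts hchar, Set.toFinset_card]
  congr 1

theorem natDegree_Ψ₂Sq_pow_le {K : Type*} [Field K] (W : WeierstrassCurve K) (n : ℕ) :
    (W.Ψ₂Sq ^ n).natDegree ≤ 3 * n := by
  refine natDegree_pow_le.trans ?_
  rw [mul_comm]
  refine Nat.mul_le_mul_right n ?_
  rw [WeierstrassCurve.Ψ₂Sq]
  compute_degree

/-- The trace of Frobenius is congruent to the Hasse invariant. -/
theorem cast_trace_eq_coeff (h2 : (2 : F) ≠ 0) (W : WeierstrassCurve F) [W.IsElliptic] {n : ℕ}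
    (hn : Fintype.card F = 2 * n + 1) :
    (((Fintype.card F : ℤ) + 1 - Nat.card W.toAffine.Point : ℤ) : F) =
      (W.Ψ₂Sq ^ n).coeff (2 * n) := by
  classical
  have hchar : ringChar F ≠ 2 := ringChar_ne_two h2
  have hn0 : 0 < n := by
    have := Fintype.one_lt_card (α := F)
    lia
  have hsum := sum_eval_eq_neg_coeff (W.Ψ₂Sq ^ n)
    ((natDegree_Ψ₂Sq_pow_le W n).trans_lt (by rw [hn]; lia))
  rw [show Fintype.card F - 1 = 2 * n by lia] at hsum
  rw [← neg_eq_iff_eq_neg] at hsum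
  rw [← hsum, card_point_eq_one_add_sum h2]
  push_cast
  simp only [quadraticChar_eq_pow_of_char_ne_two' hchar, Finset.sum_add_distrib, eval_pow,
    show Fintype.card F / 2 = n by lia]
  simp

end PointCount

/-! ### Affine substitutions and the normal form of the cubic -/

section Translation

open Polynomial

variable {K : Type*} [Field K] {p : ℕ} [Fact p.Prime] [CharP K p]

/-- Translation by b brings in a degree-i coefficient with factor binom(i, q-1), where q = p^f. This
is divisible by p for q ≤ i ≤ 2q-2, and the degree bound stops just there. -/
theorem coeff_comp_linear (f : ℕ) (g : K[X]) (hg : g.natDegree < 2 * p ^ f - 1) (a b : K) :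
    (g.comp (C a * X + C b)).coeff (p ^ f - 1) = g.coeff (p ^ f - 1) * a ^ (p ^ f - 1) := by
  have hq : 0 < p ^ f := Nat.pow_pos (Fact.out : p.Prime).pos
  have e : g.comp (C a * X + C b) = (taylor b g).comp (C a * X) := by
    rw [taylor_apply, comp_assoc]; simp
  rw [e, comp_C_mul_X_coeff, taylor_coeff]
  congr 1
  have : hasseDeriv (p ^ f - 1) g = C (g.coeff (p ^ f - 1)) := by
    ext i
    rw [hasseDeriv_coeff, coeff_C]
    split_ifs with hi
    · subst hi; simp
    rcases lt_or_ge i (p ^ f) with h | h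
    · have : p ∣ (i + (p ^ f - 1)).choose (p ^ f - 1) := by
        refine dvd_choose_of_mod_lt (f := f) Fact.out ?_
        rw [mod_eq_of_eq_add (c := 1) (r := i - 1) (by lia) (by lia), Nat.mod_eq_of_lt (by lia)]
        lia
      rw [(CharP.cast_eq_zero_iff K p _).mpr this, zero_mul]
    · rw [coeff_eq_zero_of_natDegree_lt (by lia), mul_zero]
  rw [this, eval_C]

/-- The shift b satisfies 12b + b₂ = α, so the linear term, proportional to (12b + b₂)² - c₄,
disappears and the X² and X³ terms acquire the common factor α³. -/
theorem Ψ₂Sq_comp_linear (h2 : (2 : K) ≠ 0) (h3 : (3 : K) ≠ 0) (W : WeierstrassCurve K)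
    {α : K} (hα : α ^ 2 = W.c₄) (hα0 : α ≠ 0) :
    W.Ψ₂Sq.comp (C α * X + C ((α - W.b₂) / 12)) =
      C (α ^ 3) * (4 * X ^ 3 + X ^ 2 + C (-(4 * ((α ^ 3 + W.c₆) / (864 * α ^ 3))))) := by
  have h12 : (12 : K) ≠ 0 := by
    rw [show (12 : K) = 2 * 2 * 3 by norm_num]
    exact mul_ne_zero (mul_ne_zero h2 h2) h3
  have h216 : (216 : K) ≠ 0 := by
    rw [show (216 : K) = (2 * 3) ^ 3 by norm_num]
    exact pow_ne_zero _ (mul_ne_zero h2 h3)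
  have h864 : (864 : K) ≠ 0 := by
    rw [show (864 : K) = 2 * 2 * 216 by norm_num]
    exact mul_ne_zero (mul_ne_zero h2 h2) h216
  set b := (α - W.b₂) / 12 with hb
  have hb' : 12 * b = α - W.b₂ := by rw [hb]; field_simp
  clear_value b
  have hc4 : W.c₄ = W.b₂ ^ 2 - 24 * W.b₄ := rfl
  have hc6 : W.c₆ = -W.b₂ ^ 3 + 36 * W.b₂ * W.b₄ - 216 * W.b₆ := rfl
  have e1 : 12 * b ^ 2 + 2 * W.b₂ * b + 2 * W.b₄ = 0 := by
    refine (mul_eq_zero.mp ?_).resolve_left h12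
    rw [hc4] at hα
    linear_combination (12 * b + α + W.b₂) * hb' + hα
  have e0 : 4 * b ^ 3 + W.b₂ * b ^ 2 + 2 * W.b₄ * b + W.b₆ =
      α ^ 3 * -(4 * ((α ^ 3 + W.c₆) / (864 * α ^ 3))) := by
    have hr : α ^ 3 * -(4 * ((α ^ 3 + W.c₆) / (864 * α ^ 3))) = -(α ^ 3 + W.c₆) / 216 := by
      field_simp
      ring
    have hb2 : W.b₂ = α - 12 * b := by linear_combination hb'
    rw [hr, eq_div_iff h216, hc6]
    rw [hb2] at e1 ⊢
    linear_combination (216 * b + 18 * (α - 12 * b)) * e1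
  rw [mul_add, ← C_mul, ← e0, WeierstrassCurve.Ψ₂Sq]
  simp only [add_comp, mul_comp, C_comp, X_pow_comp, X_comp, map_add, map_mul, map_pow, map_ofNat]
  have hcomp : ∀ (c : ℕ) [c.AtLeastTwo], (OfNat.ofNat c : K[X]).comp (C α * X + C b) =
      OfNat.ofNat c := fun c _ => ofNat_comp _
  simp only [hcomp]
  have e1' := congrArg (C : K → K[X]) e1
  have hb'' := congrArg (C : K → K[X]) hb'
  simp only [map_add, map_mul, map_pow, map_ofNat, map_sub, map_zero] at e1' hb''
  linear_combination C α * X * e1' + C α ^ 2 * X ^ 2 * hb''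

theorem coeff_Ψ₂Sq_pow_sq (h2 : (2 : K) ≠ 0) (h3 : (3 : K) ≠ 0) (W : WeierstrassCurve K)
    [W.IsElliptic] {α : K} (hα : α ^ 2 = W.c₄) (hα0 : α ≠ 0) {f n : ℕ}
    (hn : p ^ f = 2 * n + 1) :
    ((W.Ψ₂Sq ^ n).coeff (2 * n)) ^ 2 = W.c₄ ^ n *
      ∑ m ∈ Finset.range (p ^ f), (sexticCubeBinom m : K) * (1 / W.j) ^ m := by
  set s : K := (α ^ 3 + W.c₆) / (864 * α ^ 3) with hs
  have hq1 : p ^ f - 1 = 2 * n := by lia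
  have hc4 : W.c₄ ≠ 0 := by rw [← hα]; exact pow_ne_zero _ hα0
  have hΔ : W.Δ ≠ 0 := by rw [← W.coe_Δ']; exact W.Δ'.ne_zero
  have hj : W.j = W.c₄ ^ 3 / W.Δ := by
    rw [WeierstrassCurve.j, Units.val_inv_eq_inv_val, W.coe_Δ']
    field_simp
  -- The product is (α³ + c₆)(α³ - c₆)/(1728α⁶), and c₄³ - c₆² = 1728Δ.
  have hsj : s * (1 - 432 * s) = 1 / W.j := by
    have h := W.c_relation
    have h432 : (432 : K) ≠ 0 := by
      rw [show (432 : K) = 2 * 2 * 2 * 2 * (3 * 3 * 3) by norm_num]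
      simp [h2, h3]
    have h864 : (864 : K) ≠ 0 := by
      rw [show (864 : K) = 2 * 432 by norm_num]
      exact mul_ne_zero h2 h432
    have h1728 : (1728 : K) ≠ 0 := by
      rw [show (1728 : K) = 2 * 864 by norm_num]
      exact mul_ne_zero h2 h864
    have hs' : s * (864 * α ^ 3) = α ^ 3 + W.c₆ := by rw [hs]; field_simp
    clear_value s
    rw [hj, one_div_div, eq_div_iff (pow_ne_zero _ hc4), ← hα]
    rw [← hα] at h
    apply mul_left_cancel₀ h1728
    linear_combination (-h) + (α ^ 3 - W.c₆ - s * (864 * α ^ 3)) * hs'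
  have hdeg : (W.Ψ₂Sq ^ n).natDegree < 2 * p ^ f - 1 :=
    (natDegree_Ψ₂Sq_pow_le W n).trans_lt (by lia)
  have h := coeff_comp_linear f (W.Ψ₂Sq ^ n) hdeg α ((α - W.b₂) / 12)
  rw [pow_comp, Ψ₂Sq_comp_linear h2 h3 W hα hα0, mul_pow, ← C_pow, coeff_C_mul, hq1, ← hs,
    coeff_trinomial_pow_eq_sum h2 h3 hn, pow_mul α 2 n, hα] at h
  have hsq := sum_sexticBinom_sq (p := p) h2 h3 f s
  rw [hsj] at hsq
  rw [← hsq]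
  -- Squaring leaves only even powers of α, hence powers of c₄: the choice of square root drops out.
  have hpow : (W.c₄ ^ n) ^ 2 ≠ 0 := pow_ne_zero _ (pow_ne_zero _ hc4)
  apply mul_right_cancel₀ hpow
  rw [← mul_pow, ← h, mul_pow, ← pow_mul, ← pow_mul, show 3 * (n * 2) = 2 * (3 * n) by ring,
    pow_mul α 2, hα]
  ring

end Translation

/-! ### The congruence as an identity over the finite field -/

section FiniteField

open Polynomial

variable {F : Type*} [Field F] [Fintype F]

theorem trace_sq_eq_sum [DecidableEq F] (h2 : (2 : F) ≠ 0) (h3 : (3 : F) ≠ 0)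
    (W : WeierstrassCurve F) [W.IsElliptic] (hc4 : W.c₄ ≠ 0) (hc6 : W.c₆ ≠ 0) :
    (((Fintype.card F : ℤ) + 1 - Nat.card W.toAffine.Point : ℤ) : F) ^ 2 =
      quadraticChar F (1 - 1728 / W.j) *
        ∑ m ∈ Finset.range (Fintype.card F), (sexticCubeBinom m : F) * (1 / W.j) ^ m := by
  have hchar := ringChar_ne_two h2
  obtain ⟨p, _, f, hp, hcard⟩ := FiniteField.card' F
  have hodd : Fintype.card F % 2 = 1 := FiniteField.odd_card_of_char_ne_two hchar
  set n := Fintype.card F / 2 with hndef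
  have hn : Fintype.card F = 2 * n + 1 := by lia
  have hj : 1 - 1728 / W.j = W.c₆ ^ 2 / W.c₄ ^ 3 := by
    have hΔ : W.Δ ≠ 0 := by rw [← W.coe_Δ']; exact W.Δ'.ne_zero
    rw [WeierstrassCurve.j, Units.val_inv_eq_inv_val, W.coe_Δ']
    field_simp
    linear_combination -W.c_relation
  -- By Euler's criterion; modulo squares c₆²/c₄³ is c₄.
  have hchi : (quadraticChar F (1 - 1728 / W.j) : F) = W.c₄ ^ n := by
    have h1 := FiniteField.pow_card_sub_one_eq_one _ hc6
    have h2 := FiniteField.pow_card_sub_one_eq_one _ hc4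
    rw [show Fintype.card F - 1 = 2 * n by lia, pow_mul] at h1 h2
    rw [quadraticChar_eq_pow_of_char_ne_two' hchar, hj, div_pow, h1,
      div_eq_iff (pow_ne_zero _ (pow_ne_zero _ hc4)), ← mul_pow,
      show W.c₄ * W.c₄ ^ 3 = W.c₄ ^ 2 * W.c₄ ^ 2 by ring, mul_pow, h2, mul_one]
  have : Fact p.Prime := ⟨hp⟩
  -- c₄ need not be a square in F.
  let K := AlgebraicClosure F
  let φ : F →+* K := algebraMap F K
  have : CharP K p := charP_of_injective_algebraMap φ.injective p
  have : (W.map φ).IsElliptic := inferInstance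
  obtain ⟨α, hα⟩ := IsAlgClosed.exists_pow_nat_eq (φ W.c₄) (n := 2) (by norm_num)
  have hα0 : α ≠ 0 := by
    rintro rfl
    rw [zero_pow (by norm_num), eq_comm, map_eq_zero] at hα
    exact hc4 hα
  have key := coeff_Ψ₂Sq_pow_sq (K := K) (p := p)
    (by rw [← map_ofNat φ 2]; exact (map_ne_zero φ).mpr h2)
    (by rw [← map_ofNat φ 3]; exact (map_ne_zero φ).mpr h3) (W.map φ)
    (α := α) (by rw [WeierstrassCurve.map_c₄, hα]) hα0 (f := f) (n := n) (by rw [← hcard, hn])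
  rw [hchi, cast_trace_eq_coeff h2 W hn, hcard]
  apply φ.injective
  simp only [map_pow, map_mul, map_sum, map_natCast, map_div₀, map_one]
  rw [WeierstrassCurve.map_c₄, WeierstrassCurve.map_j, WeierstrassCurve.map_Ψ₂Sq,
    ← Polynomial.map_pow, coeff_map] at key
  exact key

end FiniteField

/-! ### Hypergeometric terms as integers -/

/-- Both sides have the same term ratio, since 1728(m + 1/2)(m + 1/6)(m + 5/6) = 24(2m + 1)(6m +
1)(6m + 5). -/
theorem hypergeometric_coeff {K : Type*} [Field K] [CharZero K] (m : ℕ) (z : K) :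
    (∏ i, (ascPochhammer K m).eval (![(1 / 2 : K), 1 / 6, 5 / 6] i)) /
        (∏ i, (ascPochhammer K m).eval (![(1 : K), 1] i)) * ((1728 * z) ^ m / (m.factorial : K)) =
      sexticCubeBinom m * z ^ m := by
  simp only [Fin.prod_univ_three, Fin.prod_univ_two, Matrix.cons_val]
  rw [ascPochhammer_eval_one]
  induction m with
  | zero => simp [sexticCubeBinom, sexticBinom]
  | succ m ih =>
    have hs : (sexticCubeBinom (m + 1) : K) * (m + 1) ^ 3 =
      24 * (6 * m + 1) * (6 * m + 5) * (2 * m + 1) * sexticCubeBinom m := by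
      exact_mod_cast sexticCubeBinom_succ m
    have hf : (m.factorial : K) ≠ 0 := by exact_mod_cast m.factorial_ne_zero
    have hm : (m : K) + 1 ≠ 0 := by exact_mod_cast m.succ_ne_zero
    rw [ascPochhammer_succ_eval, ascPochhammer_succ_eval, ascPochhammer_succ_eval,
      Nat.factorial_succ]
    push_cast
    have : (sexticCubeBinom (m + 1) : K) =
        24 * (6 * m + 1) * (6 * m + 5) * (2 * m + 1) * sexticCubeBinom m / (m + 1) ^ 3 := by
      rw [eq_div_iff (pow_ne_zero _ hm), hs]
    rw [this]
    calc _ = (Polynomial.eval (1 / 2) (ascPochhammer K m) * Polynomial.eval (1 / 6) (ascPochhammer K m) *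
          Polynomial.eval (5 / 6) (ascPochhammer K m) / (↑m.factorial * ↑m.factorial) *
          ((1728 * z) ^ m / ↑m.factorial)) * (24 * (6 * m + 1) * (6 * m + 5) * (2 * m + 1) * z /
            (m + 1) ^ 3) := by
          field_simp
          ring
      _ = _ := by rw [ih, pow_succ z m]; field_simp

theorem truncatedHypergeometric_eq_sum {K : Type*} [Field K] [CharZero K] (z : K) (r : ℕ) :
    truncatedHypergeometric ![(1 / 2 : K), 1 / 6, 5 / 6] ![(1 : K), 1] (1728 * z) r =
      ∑ m ∈ Finset.range (r + 1), (sexticCubeBinom m : K) * z ^ m :=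
  Finset.sum_congr rfl fun m _ => hypergeometric_coeff m z

/-! ### Residue fields and the passage back to L -/

section Residue

variable {L : Type*} [Field L] [NumberField L] (v : HeightOneSpectrum (𝓞 L))

theorem coe_ofNat_localRingAt (n : ℕ) [n.AtLeastTwo] :
    ((OfNat.ofNat n : LocalRingAt v) : L) = OfNat.ofNat n :=
  map_ofNat (algebraMap (LocalRingAt v) L) n

/-- The ring of integers maps onto the residue field of the local ring at `v`. -/
noncomputable def toResidueFieldAt : 𝓞 L →+* ResidueFieldAt v :=
  (IsLocalRing.residue (LocalRingAt v)).comp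
    ((algebraMap (𝓞 L) L).codRestrict (v.valuation L).integer fun x => v.valuation_le_one x)

theorem residue_eq_zero_iff_valuation_lt_one (x : LocalRingAt v) :
    IsLocalRing.residue (LocalRingAt v) x = 0 ↔ v.valuation L (x : L) < 1 := by
  rw [IsLocalRing.residue_eq_zero_iff, IsLocalRing.mem_maximalIdeal, mem_nonunits_iff,
    Valuation.Integers.isUnit_iff_valuation_eq_one (Valuation.integer.integers _)]
  exact (lt_iff_le_and_ne.trans (and_iff_right x.2)).symm

/-- By approximation the ring of integers already surjects onto the residue field, with kernel v. -/
theorem natCard_residueFieldAt : Nat.card (ResidueFieldAt v) = Ideal.absNorm v.asIdeal := by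
  have hsurj : Function.Surjective (toResidueFieldAt v) := by
    intro y
    obtain ⟨x, rfl⟩ := IsLocalRing.residue_surjective y
    obtain ⟨a, ha⟩ := v.exists_valuation_sub_lt_of_integer x.2 1
    refine ⟨a, ?_⟩
    rw [← sub_eq_zero, toResidueFieldAt, RingHom.comp_apply, ← map_sub,
      residue_eq_zero_iff_valuation_lt_one]
    exact ha
  have hker : RingHom.ker (toResidueFieldAt v) = v.asIdeal := by
    ext a
    rw [RingHom.mem_ker, toResidueFieldAt, RingHom.comp_apply,
      residue_eq_zero_iff_valuation_lt_one]
    exact v.valuation_lt_one_iff_mem a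
  rw [← Nat.card_congr (RingHom.quotientKerEquivOfSurjective hsurj).toEquiv, hker,
    Ideal.absNorm_apply, Submodule.cardQuot_apply]

theorem finite_residueFieldAt : Finite (ResidueFieldAt v) := by
  apply Nat.finite_of_card_ne_zero
  rw [natCard_residueFieldAt]
  exact Ideal.absNorm_eq_zero_iff.not.mpr v.ne_bot

theorem primeLegendreSym_eq_quadraticChar [Fintype (ResidueFieldAt v)]
    [DecidableEq (ResidueFieldAt v)] (a : LocalRingAt v) :
    primeLegendreSym v (a : L) =
      quadraticChar (ResidueFieldAt v) (IsLocalRing.residue (LocalRingAt v) a) := by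
  have ha : v.valuation L (a : L) ≤ 1 := a.2
  rw [primeLegendreSym, dif_pos ha, quadraticChar_apply, quadraticCharFun]
  dsimp only
  split_ifs <;> rfl

end Residue

theorem WeierstrassCurve.j_mul_Δ {K : Type*} [CommRing K] (W : WeierstrassCurve K)
    [W.IsElliptic] : W.j * W.Δ = W.c₄ ^ 3 := by
  rw [WeierstrassCurve.j, ← W.coe_Δ', mul_right_comm, Units.inv_mul, one_mul]

theorem WeierstrassCurve.j_minimal (R : Type*) [CommRing R] [IsDomain R]
    [IsDiscreteValuationRing R] {K : Type*} [Field K] [Algebra R K] [IsFractionRing R K]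
    (E : WeierstrassCurve K) [E.IsElliptic] :
    E.j * (E.minimal R).Δ = (E.minimal R).c₄ ^ 3 := by
  rw [WeierstrassCurve.minimal, ← WeierstrassCurve.j_mul_Δ, WeierstrassCurve.variableChange_j]

theorem theorem1p1 {L : Type*} [Field L] [NumberField L]
    (E : WeierstrassCurve L) [E.IsElliptic]
    (hj0 : E.j ≠ 0) (hj1728 : E.j ≠ 1728)
    (v : HeightOneSpectrum (𝓞 L))
    (hgood : IsGoodPrime E v)
    (h6 : (6 : 𝓞 L) ∉ v.asIdeal)
    (hvj : v.valuation L E.j = 1)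
    (hvj' : v.valuation L (E.j - 1728) = 1) :
    CongrModPrime v
      ((frobeniusTrace E v : L) ^ 2)
      ((primeLegendreSym v (1 - 1728 / E.j) : L) *
        truncatedHypergeometric ![(1 / 2 : L), 1 / 6, 5 / 6] ![(1 : L), 1] (1728 / E.j)
          (Ideal.absNorm v.asIdeal - 1)) := by
  classical
  have := finite_residueFieldAt v
  let _ : Fintype (ResidueFieldAt v) := Fintype.ofFinite _
  set R := LocalRingAt v
  set π := IsLocalRing.residue R
  have hcard : Fintype.card (ResidueFieldAt v) = Ideal.absNorm v.asIdeal := by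
    rw [← natCard_residueFieldAt, Nat.card_eq_fintype_card]
  set W := (E.minimal R).reduction R with hW
  have hell : W.IsElliptic :=
    (WeierstrassCurve.hasGoodReduction_iff_isElliptic_reduction (R := R)).mp hgood
  let J : R := ⟨E.j, hvj.le⟩
  let J' : R := ⟨E.j⁻¹, by rw [Valuation.mem_integer_iff, map_inv₀, hvj, inv_one]⟩
  have hJJ' : J * J' = 1 := Subtype.ext (mul_inv_cancel₀ hj0)
  -- The division-free relation jΔ = c₄³ descends to the integral model and then reduces modulo v.
  have hjW : W.j = π J := by
    let I := (E.minimal R).integralModel R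
    have hI : J * I.Δ = I.c₄ ^ 3 := by
      apply FaithfulSMul.algebraMap_injective R L
      rw [map_mul, map_pow, WeierstrassCurve.integralModel_Δ_eq,
        WeierstrassCurve.integralModel_c₄_eq]
      exact E.j_minimal R
    have hπ : π J * W.Δ = W.c₄ ^ 3 := by
      have := congrArg π hI
      rw [map_mul, map_pow] at this
      rw [hW, WeierstrassCurve.reduction, WeierstrassCurve.map_Δ, WeierstrassCurve.map_c₄]
      exact this
    have hΔ : W.Δ ≠ 0 := by rw [← W.coe_Δ']; exact W.Δ'.ne_zero
    exact mul_right_cancel₀ hΔ (W.j_mul_Δ.trans hπ.symm)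
  have h6' : (6 : ResidueFieldAt v) ≠ 0 := by
    intro h
    have : π (6 : R) = 0 := by rw [map_ofNat]; exact h
    rw [residue_eq_zero_iff_valuation_lt_one, coe_ofNat_localRingAt,
      ← map_ofNat (algebraMap (𝓞 L) L) 6] at this
    exact h6 ((v.valuation_lt_one_iff_mem (K := L) 6).mp this)
  have h2 : (2 : ResidueFieldAt v) ≠ 0 := fun h => h6' (by linear_combination 3 * h)
  have h3 : (3 : ResidueFieldAt v) ≠ 0 := fun h => h6' (by linear_combination 2 * h)
  have hc4 : W.c₄ ≠ 0 := by
    intro h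
    have h' : π J = 0 := by rw [← hjW, W.j_eq_zero h]
    rw [residue_eq_zero_iff_valuation_lt_one] at h'
    exact h'.ne hvj
  have hc6 : W.c₆ ≠ 0 := by
    intro h
    have h' : π (J - 1728) = 0 := by
      rw [map_sub, map_ofNat, ← hjW, sub_eq_zero, WeierstrassCurve.j]
      have hr := W.c_relation
      rw [h] at hr
      rw [show W.c₄ ^ 3 = 1728 * W.Δ by linear_combination -hr, ← W.coe_Δ', mul_left_comm,
        Units.inv_mul, mul_one]
    rw [residue_eq_zero_iff_valuation_lt_one] at h'
    exact h'.ne hvj'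
  have hπJ' : π J' = 1 / W.j := by
    rw [hjW, eq_div_iff, mul_comm, ← map_mul, hJJ', map_one]
    exact left_ne_zero_of_mul_eq_one (b := π J') (by rw [← map_mul, hJJ', map_one])
  have key := trace_sq_eq_sum h2 h3 W hc4 hc6
  have harg : 1 - 1728 / E.j = ((1 - 1728 * J' : R) : L) := by
    rw [div_eq_mul_inv, ← coe_ofNat_localRingAt v 1728]
    rfl
  have hq : Ideal.absNorm v.asIdeal - 1 + 1 = Ideal.absNorm v.asIdeal :=
    Nat.sub_add_cancel (by rw [← hcard]; exact Fintype.card_pos)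
  rw [CongrModPrime, harg, primeLegendreSym_eq_quadraticChar, div_eq_mul_inv 1728,
    truncatedHypergeometric_eq_sum, hq]
  -- The difference of the two sides, lifted to the local ring: integrality of the coefficients and
  -- of 1/j lets it be reduced termwise.
  let S : R := (frobeniusTrace E v : R) ^ 2 -
    (quadraticChar (ResidueFieldAt v) (π (1 - 1728 * J')) : R) *
      ∑ m ∈ Finset.range (Ideal.absNorm v.asIdeal), (sexticCubeBinom m : R) * J' ^ m
  have hS : π S = 0 := by
    simp only [S, map_sub, map_mul, map_pow, map_sum, map_intCast, map_natCast, map_one, map_ofNat]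
    rw [sub_eq_zero, hπJ', ← hcard, frobeniusTrace, ← hcard]
    rw [mul_one_div]
    exact key
  rw [residue_eq_zero_iff_valuation_lt_one] at hS
  have hcoe : ∀ a c : ℤ, algebraMap R L ((a : R) ^ 2 - (c : R) *
      ∑ m ∈ Finset.range (Ideal.absNorm v.asIdeal), (sexticCubeBinom m : R) * J' ^ m) =
      (a : L) ^ 2 - (c : L) * ∑ m ∈ Finset.range (Ideal.absNorm v.asIdeal),
        (sexticCubeBinom m : L) * E.j⁻¹ ^ m := by
    intro a c
    simp only [map_sub, map_mul, map_pow, map_sum, map_intCast, map_natCast]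
    rfl
  rw [← hcoe]
  exact hS
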